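/- Let $k$ be a field and let $l\ge 2$ be an integer. Index the rows and columns of $2l\times 2l$ matrices by $1,\dots,l,-1,\dots,-l$ and those of $(2l+1)\times(2l+1)$ matrices by $0,1,\dots,l,-1,\dots,-l$, and write $e_{a,b}$ for the matrix with $1$ in position $(a,b)$ and $0$ elsewhere. Let $\mathrm{Sp}(2l,k)$, $\mathrm{O}(2l,k)$ and $\mathrm{O}(2l+1,k)$ be the groups of matrices $X$ over $k$ with ${}^TX\beta X=\beta$, where $\beta$ is respectively $$\begin{pmatrix}0&I_l\\-I_l&0\end{pmatrix},\qquad \begin{pmatrix}0&I_l\\ I_l&0\end{pmatrix},\qquad \begin{pmatrix}2&0&0\\0&0&I_l\\0&I_l&0\end{pmatrix}.$$ The elementary matrices are the following, where $t\in k$ and $1\le i,j\le l$. For $\mathrm{O}(2l,k)$: $I+t(e_{i,j}-e_{-j,-i})$ for $i\ne j$; $I+t(e_{i,-j}-e_{j,-i})$ and $I+t(e_{-i,j}-e_{-j,i})$ for $i<j$; and $w_l=I-e_{l,l}-e_{-l,-l}-e_{l,-l}-e_{-l,l}$. For $\mathrm{O}(2l+1,k)$: $I+t(e_{i,j}-e_{-j,-i})$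 for $i\ne j$; $I+t(e_{i,-j}-e_{j,-i})$ and $I+t(e_{-i,j}-e_{-j,i})$ for $i<j$; $I+t(2e_{i,0}-e_{0,-i})-t^2e_{i,-i}$; and $I+t(-2e_{-i,0}+e_{0,i})-t^2e_{-i,i}$. For $\mathrm{Sp}(2l,k)$: $I+t(e_{i,j}-e_{-j,-i})$ for $i\ne j$; $I+t(e_{i,-j}+e_{j,-i})$ and $I+t(e_{-i,j}+e_{-j,i})$ for $i<j$; $I+te_{i,-i}$; and $I+te_{-i,i}$. ($\mathcal A$) Suppose that the characteristic of $k$ is not $2$. Every $g\in\mathrm{O}(2l,k)$ can be written as $g=x_1\cdots x_n\,\mathrm{diag}(1,\dots,1,\lambda,1,\dots,1,\lambda^{-1})$ with $n\ge 0$, elementary matrices $x_1,\dots,x_n$ for $\mathrm{O}(2l,k)$, and $\lambda\in k^\times$. Every $g\in\mathrm{O}(2l+1,k)$ can be written as $g=x_1\cdots x_n\,\mathrm{diag}(\vartheta,1,\dots,1,\lambda,1,\dots,1,\lambda^{-1})$ with $n\ge 0$, elementary matrices $x_1,\dots,x_n$ for $\mathrm{O}(2l+1,k)$, $\lambda\in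 k^\times$ and $\vartheta=\pm1$. Here $\lambda$ and $\lambda^{-1}$ stand in the positions $(l,l)$ and $(-l,-l)$. ($\mathcal B$) For $k$ of any characteristic, every element of $\mathrm{Sp}(2l,k)$ is a product of elementary matrices for $\mathrm{Sp}(2l,k)$. -/

import Mathlib

open Matrix

/-- Indices `1, …, l, -1, …, -l`: `Sum.inl i` stands for `i`, and `Sum.inr i` for `-i`
(with `Fin l` in the role of `{1, …, l}`). -/
abbrev EvenIndex (l : ℕ) : Type := Fin l ⊕ Fin l

/-- Indices `0, 1, …, l, -1, …, -l`. -/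
abbrev OddIndex (l : ℕ) : Type := Unit ⊕ EvenIndex l

namespace EvenIndex

/-- The index `i`. -/
abbrev pos {l : ℕ} (i : Fin l) : EvenIndex l := Sum.inl i

/-- The index `-i`. -/
abbrev neg {l : ℕ} (i : Fin l) : EvenIndex l := Sum.inr i

end EvenIndex

namespace OddIndex

/-- The index `0`. -/
abbrev zero {l : ℕ} : OddIndex l := Sum.inl ()

/-- The index `i`. -/
abbrev pos {l : ℕ} (i : Fin l) : OddIndex l := Sum.inr (EvenIndex.pos i)

/-- The index `-i`. -/
abbrev neg {l : ℕ} (i : Fin l) : OddIndex l := Sum.inr (EvenIndex.neg i)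

end OddIndex

/-- The split symmetric form `(0 I; I 0)` in dimension `2l`. -/
def splitFormEven (l : ℕ) (k : Type*) [Field k] : Matrix (EvenIndex l) (EvenIndex l) k :=
  fromBlocks 0 1 1 0

/-- The split symmetric form `(2 0 0; 0 0 I; 0 I 0)` in dimension `2l + 1`. -/
def splitFormOdd (l : ℕ) (k : Type*) [Field k] : Matrix (OddIndex l) (OddIndex l) k :=
  fromBlocks (diagonal fun _ => 2) 0 0 (splitFormEven l k)

/-- The alternating form `(0 I; -I 0)` in dimension `2l`. -/
def alternatingForm (l : ℕ) (k : Type*) [Field k] : Matrix (EvenIndex l) (EvenIndex l) k :=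
  fromBlocks 0 1 (-1) 0

/-- The matrices `X` with `Xᵀ β X = β`. For an invertible `β` (as are the three forms above, the
odd-dimensional one outside characteristic 2) all of them are invertible, and they form
a group. -/
def matrixIsometries {n k : Type*} [Fintype n] [DecidableEq n] [Field k] (β : Matrix n n k) :
    Submonoid (Matrix n n k) where
  carrier := {X | Xᵀ * β * X = β}
  one_mem' := by simp
  mul_mem' := by
    intro X Y hX hY
    have hX' : Xᵀ * β * X = β := hX
    have hY' : Yᵀ * β * Y = β := hY
    calc (X * Y)ᵀ * β * (X * Y) = Yᵀ * (Xᵀ * β * X) * Y := by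
          simp only [transpose_mul, Matrix.mul_assoc]
      _ = β := by rw [hX', hY']

/-- The split orthogonal group `O(2l, k)`. -/
def splitOrthogonalEven (l : ℕ) (k : Type*) [Field k] :
    Submonoid (Matrix (EvenIndex l) (EvenIndex l) k) :=
  matrixIsometries (splitFormEven l k)

/-- The split orthogonal group `O(2l + 1, k)`. -/
def splitOrthogonalOdd (l : ℕ) (k : Type*) [Field k] :
    Submonoid (Matrix (OddIndex l) (OddIndex l) k) :=
  matrixIsometries (splitFormOdd l k)

/-- The symplectic group `Sp(2l, k)`. -/
def symplecticMatrices (l : ℕ) (k : Type*) [Field k] :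
    Submonoid (Matrix (EvenIndex l) (EvenIndex l) k) :=
  matrixIsometries (alternatingForm l k)

/-- It is Mathlib's symplectic group. -/
theorem symplecticMatrices_eq (l : ℕ) (k : Type*) [Field k] :
    symplecticMatrices l k = Matrix.symplecticGroup (Fin l) k := by
  have h : alternatingForm l k = -Matrix.J (Fin l) k := by
    simp [alternatingForm, Matrix.J, Matrix.fromBlocks_neg]
  ext X
  rw [SymplecticGroup.mem_iff']
  change Xᵀ * alternatingForm l k * X = alternatingForm l k ↔ _
  rw [h]
  simp

section Elementary

open EvenIndex in
/-- The elementary matrices of `O(2l, k)`, including `w_l`. -/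
inductive IsElementaryEven {l : ℕ} {k : Type*} [Field k] :
    Matrix (EvenIndex l) (EvenIndex l) k → Prop
  /-- `x_{i,j}(t)`, `i ≠ j`. -/
  | xPosPos (i j : Fin l) (t : k) (h : i ≠ j) : IsElementaryEven
      (1 + t • (single (pos i) (pos j) 1 - single (neg j) (neg i) 1))
  /-- `x_{i,-j}(t)`, `i < j`. -/
  | xPosNeg (i j : Fin l) (t : k) (h : i < j) : IsElementaryEven
      (1 + t • (single (pos i) (neg j) 1 - single (pos j) (neg i) 1))
  /-- `x_{-i,j}(t)`, `i < j`. -/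
  | xNegPos (i j : Fin l) (t : k) (h : i < j) : IsElementaryEven
      (1 + t • (single (neg i) (pos j) 1 - single (neg j) (pos i) 1))
  /-- `w_l`; here `p` is the index `l`, the last element of `Fin l`. -/
  | w (p : Fin l) (h : (p : ℕ) + 1 = l) : IsElementaryEven
      (1 - single (pos p) (pos p) 1 - single (neg p) (neg p) 1
        - single (pos p) (neg p) 1 - single (neg p) (pos p) 1)

open OddIndex in
/-- The elementary matrices of `O(2l + 1, k)`. -/
inductive IsElementaryOdd {l : ℕ} {k : Type*} [Field k] :
    Matrix (OddIndex l) (OddIndex l) k → Prop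
  /-- `x_{i,j}(t)`, `i ≠ j`. -/
  | xPosPos (i j : Fin l) (t : k) (h : i ≠ j) : IsElementaryOdd
      (1 + t • (single (pos i) (pos j) 1 - single (neg j) (neg i) 1))
  /-- `x_{i,-j}(t)`, `i < j`. -/
  | xPosNeg (i j : Fin l) (t : k) (h : i < j) : IsElementaryOdd
      (1 + t • (single (pos i) (neg j) 1 - single (pos j) (neg i) 1))
  /-- `x_{-i,j}(t)`, `i < j`. -/
  | xNegPos (i j : Fin l) (t : k) (h : i < j) : IsElementaryOdd
      (1 + t • (single (neg i) (pos j) 1 - single (neg j) (pos i) 1))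
  /-- `x_{i,0}(t)`. -/
  | xPosZero (i : Fin l) (t : k) : IsElementaryOdd
      (1 + t • (single (pos i) zero 2 - single zero (neg i) 1)
        - t ^ 2 • single (pos i) (neg i) 1)
  /-- `x_{0,i}(t)`. -/
  | xZeroPos (i : Fin l) (t : k) : IsElementaryOdd
      (1 + t • (single zero (pos i) 1 - single (neg i) zero 2)
        - t ^ 2 • single (neg i) (pos i) 1)

open EvenIndex in
/-- The elementary matrices of `Sp(2l, k)`. -/
inductive IsElementarySymplectic {l : ℕ} {k : Type*} [Field k] :
    Matrix (EvenIndex l) (EvenIndex l) k → Prop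
  /-- `x_{i,j}(t)`, `i ≠ j`. -/
  | xPosPos (i j : Fin l) (t : k) (h : i ≠ j) : IsElementarySymplectic
      (1 + t • (single (pos i) (pos j) 1 - single (neg j) (neg i) 1))
  /-- `x_{i,-j}(t)`, `i < j`. -/
  | xPosNeg (i j : Fin l) (t : k) (h : i < j) : IsElementarySymplectic
      (1 + t • (single (pos i) (neg j) 1 + single (pos j) (neg i) 1))
  /-- `x_{-i,j}(t)`, `i < j`. -/
  | xNegPos (i j : Fin l) (t : k) (h : i < j) : IsElementarySymplectic
      (1 + t • (single (neg i) (pos j) 1 + single (neg j) (pos i) 1))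
  /-- `x_{i,-i}(t)`. -/
  | xPosNegSelf (i : Fin l) (t : k) : IsElementarySymplectic
      (1 + t • single (pos i) (neg i) 1)
  /-- `x_{-i,i}(t)`. -/
  | xNegPosSelf (i : Fin l) (t : k) : IsElementarySymplectic
      (1 + t • single (neg i) (pos i) 1)

end Elementary

/-- The diagonal of `diag(1, …, 1, lam, 1, …, 1, lam⁻¹)`: the entry `lam` is at the index `l`
and the entry `lam⁻¹` at the index `-l`. -/
def diagEntries (l : ℕ) {k : Type*} [Field k] (lam : kˣ) : EvenIndex l → k :=
  Sum.elim (fun i => if (i : ℕ) + 1 = l then (lam : k) else 1)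
    (fun i => if (i : ℕ) + 1 = l then (lam : k)⁻¹ else 1)

/-- `diag(1, …, 1, lam, 1, …, 1, lam⁻¹)` of size `2l`. -/
def diagEven (l : ℕ) {k : Type*} [Field k] (lam : kˣ) : Matrix (EvenIndex l) (EvenIndex l) k :=
  diagonal (diagEntries l lam)

/-- `diag(th, 1, …, 1, lam, 1, …, 1, lam⁻¹)` of size `2l + 1`. -/
def diagOdd (l : ℕ) {k : Type*} [Field k] (th : k) (lam : kˣ) :
    Matrix (OddIndex l) (OddIndex l) k :=
  diagonal (Sum.elim (fun _ => th) (diagEntries l lam))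

/-! The argument is Gaussian elimination by left multiplication, performed on the columns `g *ᵥ
Pi.single c 1` and controlled by the form. The symplectic and even orthogonal cases run together:
both forms are `(0 I; ε I 0)` with `ε = ∓1`, and all elementary matrices other than `w_l` and the
transvections `I + t e_{a,-a}` are instances of `rootMatrix ε a b t`, where negating an index is
`Sum.swap`.

The form pairs `e_c` only with `e_{-c}`. Hence an isometry fixing `e_c` preserves the coordinate
`-c` of every vector (`apply_swap_of_fixes`), so once `e_c` and `e_{-c}` are fixed, the other
columns vanish at `±c` and later operations can avoid these indices. A nonzero column gets the entry
1 at `a` (`exists_apply_eq_one`), and this pivot clears everything outside `±a` (`exists_clear`).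
The entry at `-a` is removed by a transvection in the symplectic case; in the orthogonal case
isotropy makes it zero, since 2 is invertible. The column `-a` then has pivot 1 automatically.
Treating all pairs but one (`IsReducing.exists_fixes_off`) leaves a single hyperbolic plane. There
transvections finish the symplectic case, and `w_l` and one diagonal matrix the orthogonal one.

In odd dimension, `g e_0` is first moved to `±e_0` (`exists_mulVec_eq_single_zero`). After
correcting the sign, orthogonality to `e_0` makes the matrix a block sum `1 ⊕ X` with `X` in `O(2l,
k)`. The even case applies to `X`; its factors `w_l` lift to `-1 ⊕ w_l`, a product of three short
root elements, and the resulting signs are collected in `ϑ`. -/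

/-! ### Root elements for the form `(0 I; ε I 0)` and clearing a column -/

section Hyperbolic

variable {k : Type*} [Field k] {l : ℕ}

/-- The form `(0 I; ε I 0)` in dimension `2l`. -/
def hyperbolicForm (l : ℕ) (ε : k) : Matrix (EvenIndex l) (EvenIndex l) k :=
  fromBlocks 0 1 (ε • 1) 0

/-- The value of the form `(0 I; ε I 0)` on the pair `e_a, e_{-a}`. -/
def pairSign (ε : k) : EvenIndex l → k :=
  Sum.elim (fun _ => 1) (fun _ => ε)

theorem pairSign_mul_self {ε : k} (hε : ε * ε = 1) (a : EvenIndex l) :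
    pairSign ε a * pairSign ε a = 1 := by
  rcases a with a | a <;> simp [pairSign, hε]

theorem pairSign_ne_zero {ε : k} (hε : ε * ε = 1) (a : EvenIndex l) : pairSign ε a ≠ 0 := by
  intro h
  have := pairSign_mul_self hε a
  simp [h] at this

theorem pairSign_swap {ε : k} (hε : ε * ε = 1) (a : EvenIndex l) :
    pairSign ε a.swap = ε * pairSign ε a := by
  rcases a with a | a <;> simp [pairSign, hε]

theorem EvenIndex.swap_ne_self (a : EvenIndex l) : a.swap ≠ a := by
  rcases a with a | a <;> simp

theorem EvenIndex.swap_eq_iff {a b : EvenIndex l} : a.swap = b ↔ a = b.swap :=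
  ⟨fun h => by rw [← h, Sum.swap_swap], fun h => by rw [h, Sum.swap_swap]⟩

theorem dotProduct_hyperbolicForm (ε : k) (v w : EvenIndex l → k) :
    v ⬝ᵥ hyperbolicForm l ε *ᵥ w = ∑ c, pairSign ε c * v c * w c.swap := by
  rw [hyperbolicForm, fromBlocks_mulVec]
  simp only [dotProduct, Fintype.sum_sum_type, pairSign, Sum.elim_inl, Sum.elim_inr,
    Sum.swap_inl, Sum.swap_inr, zero_mulVec, one_mulVec, smul_mulVec, zero_add, add_zero,
    Pi.smul_apply, Function.comp, smul_eq_mul, one_mul]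
  congr 1
  exact Finset.sum_congr rfl fun c _ => by ring

theorem mem_matrixIsometries_iff {n : Type*} [Fintype n] [DecidableEq n] {β g : Matrix n n k} :
    g ∈ matrixIsometries β ↔ ∀ v w : n → k, (g *ᵥ v) ⬝ᵥ β *ᵥ (g *ᵥ w) = v ⬝ᵥ β *ᵥ w := by
  have key : ∀ v w : n → k, (g *ᵥ v) ⬝ᵥ β *ᵥ (g *ᵥ w) = v ⬝ᵥ (gᵀ * β * g) *ᵥ w := by
    intro v w
    rw [dotProduct_comm, dotProduct_mulVec, ← mulVec_transpose, dotProduct_comm]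
    simp only [mulVec_mulVec, Matrix.mul_assoc]
  simp only [key]
  constructor
  · intro h v w
    rw [show gᵀ * β * g = β from h]
  · intro h
    change gᵀ * β * g = β
    ext i j
    simpa using h (Pi.single i 1) (Pi.single j 1)

/-- Pairing with `e_c` reads off the coordinate `-c` up to a nonzero factor, and `g` preserves the
pairing with the fixed vector `e_c`. -/
theorem apply_swap_of_fixes {ε : k} (hε : ε * ε = 1) {g : Matrix (EvenIndex l) (EvenIndex l) k}
    (hg : g ∈ matrixIsometries (hyperbolicForm l ε)) {c : EvenIndex l}
    (hc : g *ᵥ Pi.single c 1 = Pi.single c 1) (v : EvenIndex l → k) :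
    (g *ᵥ v) c.swap = v c.swap := by
  have h := mem_matrixIsometries_iff.1 hg (Pi.single c 1) v
  rw [hc] at h
  simp only [dotProduct_hyperbolicForm, mul_assoc] at h
  rw [Finset.sum_eq_single c, Finset.sum_eq_single c] at h
  · simpa [pairSign_ne_zero hε c] using h
  all_goals simp +contextual

/-- The matrix `I + t (e_{a,b} - s_a s_b e_{-b,-a})`, where `s` is `pairSign ε`. -/
def rootMatrix (ε : k) (a b : EvenIndex l) (t : k) : Matrix (EvenIndex l) (EvenIndex l) k :=
  1 + t • (single a b 1 - (pairSign ε a * pairSign ε b) • single b.swap a.swap 1)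

theorem rootMatrix_mulVec (ε : k) (a b : EvenIndex l) (t : k) (v : EvenIndex l → k) :
    rootMatrix ε a b t *ᵥ v = v + Pi.single a (t * v b)
      - Pi.single b.swap (t * (pairSign ε a * pairSign ε b) * v a.swap) := by
  simp only [rootMatrix, add_mulVec, sub_mulVec, smul_mulVec, one_mulVec, single_mulVec]
  ext c
  simp [Pi.single_apply, Function.update_apply]
  split_ifs <;> ring

theorem rootMatrix_mem {ε : k} (hε : ε * ε = 1) {a b : EvenIndex l} (h1 : a ≠ b)
    (h2 : a ≠ b.swap) (t : k) : rootMatrix ε a b t ∈ matrixIsometries (hyperbolicForm l ε) := by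
  rw [mem_matrixIsometries_iff]
  intro v w
  have h3 : b.swap ≠ a.swap := fun h => h1 (by simpa using congrArg Sum.swap h.symm)
  have h4 : b ≠ a.swap := fun h => h2 (by rw [h, Sum.swap_swap])
  simp only [rootMatrix_mulVec, dotProduct_hyperbolicForm]
  have e : ∀ c d : EvenIndex l, (c.swap = d) = (c = d.swap) :=
    fun c d => propext EvenIndex.swap_eq_iff
  simp only [Pi.add_apply, Pi.sub_apply, Pi.single_apply, e, Sum.swap_swap]
  simp only [mul_add, mul_sub, add_mul, sub_mul, Finset.sum_add_distrib, Finset.sum_sub_distrib,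
    mul_ite, ite_mul, mul_zero, zero_mul, Finset.sum_ite_eq', Finset.mem_univ,
    if_true, h1.symm, h3.symm, if_false, e, Sum.swap_swap]
  have := pairSign_mul_self hε a
  have := pairSign_mul_self hε b
  have := pairSign_swap hε a
  have := pairSign_swap hε b
  grind

/-- Each root element has two names, exchanged by `(a, b) ↦ (-b, -a)`. This reduces arbitrary index
pairs to the listed ones with `i < j`. -/
theorem rootMatrix_swap {ε : k} (hε : ε * ε = 1) (a b : EvenIndex l) (t : k) :
    rootMatrix ε b.swap a.swap (-(t * (pairSign ε a * pairSign ε b))) = rootMatrix ε a b t := by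
  have ha := pairSign_mul_self hε a
  have hb := pairSign_mul_self hε b
  simp only [rootMatrix, pairSign_swap hε, Sum.swap_swap]
  ext c d
  simp [-neg_mul]
  grind

/-- The nilpotent part has square zero: `a ≠ b`, and no index equals its own negative. -/
theorem rootMatrix_neg_mul {ε : k} {a b : EvenIndex l} (h1 : a ≠ b) (h2 : a ≠ b.swap) (t : k) :
    rootMatrix ε a b (-t) * rootMatrix ε a b t = 1 := by
  have h3 : b.swap ≠ a.swap := fun h => h1 (by simpa using congrArg Sum.swap h.symm)
  have h4 : b ≠ a.swap := fun h => h2 (by rw [h, Sum.swap_swap])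
  have hN : (single a b 1 - (pairSign ε a * pairSign ε b) • single b.swap a.swap 1 :
      Matrix (EvenIndex l) (EvenIndex l) k) *
      (single a b 1 - (pairSign ε a * pairSign ε b) • single b.swap a.swap 1) = 0 := by
    simp [sub_mul, mul_sub, single_mul_single_of_ne, h1.symm, h3.symm,
      a.swap_ne_self, b.swap_ne_self.symm]
  simp only [rootMatrix, add_mul, mul_add, smul_mul_assoc, mul_smul_comm, hN]
  simp

/-- The last clause protects the columns already reduced: they are basis vectors `e_c` with `v`
vanishing at `-c`. The case `c = -a` serves to clear the second column of a hyperbolic pair without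
disturbing the first. -/
theorem exists_clear {ε : k} {E : Submonoid (Matrix (EvenIndex l) (EvenIndex l) k)}
    (hE : ∀ a b t, a ≠ b → a ≠ b.swap → rootMatrix ε a b t ∈ E)
    {a : EvenIndex l} {v : EvenIndex l → k} (hv : v a = 1) :
    ∃ x ∈ E, (x *ᵥ v) a = 1 ∧ (∀ b, b ≠ a → b ≠ a.swap → (x *ᵥ v) b = 0) ∧
      ∀ c, c ≠ a → (c = a.swap ∨ v c.swap = 0) → x *ᵥ Pi.single c 1 = Pi.single c 1 := by
  -- The coordinates are cleared one at a time. Clearing `b` alters only the coordinates `b` and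
  -- `-a`, so the pivot and the zeros already obtained survive.
  suffices H : ∀ S : Finset (EvenIndex l), a ∉ S → a.swap ∉ S → ∃ x ∈ E,
      (∀ b ∈ S, (x *ᵥ v) b = 0) ∧ (∀ b, b ∉ S → b ≠ a.swap → (x *ᵥ v) b = v b) ∧
      ∀ c, c ≠ a → (c = a.swap ∨ v c.swap = 0) → x *ᵥ Pi.single c 1 = Pi.single c 1 by
    obtain ⟨x, hx, h1, h2, h3⟩ := H (Finset.univ \ {a, a.swap}) (by simp) (by simp)
    refine ⟨x, hx, ?_, fun b hb hb' => h1 b (by simp [hb, hb']), h3⟩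
    rw [h2 a (by simp) a.swap_ne_self.symm, hv]
  intro S
  induction S using Finset.induction_on with
  | empty => exact fun _ _ => ⟨1, E.one_mem, by simp, by simp, fun c _ _ => one_mulVec _⟩
  | insert b S hb ih =>
    intro ha ha'
    simp only [Finset.mem_insert, not_or] at ha ha'
    obtain ⟨x, hx, h1, h2, h3⟩ := ih ha.2 ha'.2
    refine ⟨rootMatrix ε b a (-v b) * x, E.mul_mem (hE _ _ _ (Ne.symm ha.1) (Ne.symm ha'.1)) hx,
      ?_, ?_, ?_⟩
    · intro c hc
      have hca : c ≠ a.swap := by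
        rintro rfl
        exact (Finset.mem_insert.1 hc).elim ha'.1 ha'.2
      rw [← mulVec_mulVec, rootMatrix_mulVec, Pi.sub_apply, Pi.add_apply,
        Pi.single_eq_of_ne hca, h2 a ha.2 a.swap_ne_self.symm, hv]
      rcases Finset.mem_insert.1 hc with rfl | hc
      · rw [h2 c hb hca]; simp
      · rw [h1 c hc, Pi.single_eq_of_ne (ne_of_mem_of_not_mem hc hb)]; simp
    · intro c hc hca
      simp only [Finset.mem_insert, not_or] at hc
      rw [← mulVec_mulVec, rootMatrix_mulVec, Pi.sub_apply, Pi.add_apply,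
        Pi.single_eq_of_ne hca, Pi.single_eq_of_ne hc.1, h2 c hc.2 hca]
      simp
    · intro c hc hc'
      rw [← mulVec_mulVec, h3 c hc hc', rootMatrix_mulVec, Pi.single_eq_of_ne hc.symm]
      -- Besides `e_a`, the new factor can move only `e_{-b}`, by a multiple of `v b`. For `c = -b`
      -- the hypothesis says that `v b = 0`.
      rcases eq_or_ne c b.swap with rfl | hcb
      · rcases hc' with h | h
        · exact absurd (by simpa using congrArg Sum.swap h.symm) ha.1
        · rw [Sum.swap_swap] at h
          simp [h]
      · rw [Pi.single_eq_of_ne hcb.symm]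
        simp

/-- The set `F` holds the indices already treated. A nonzero entry outside `±a` can be used to
adjust the entry at `a`; the spare index `p` provides such an entry when `v` is supported on `±a`.
-/
theorem exists_apply_eq_one {ε : k} {E : Submonoid (Matrix (EvenIndex l) (EvenIndex l) k)}
    (hE : ∀ a b t, a ≠ b → a ≠ b.swap → rootMatrix ε a b t ∈ E)
    {a p : EvenIndex l} (hap : a ≠ p) (hap' : a ≠ p.swap) {F : Set (EvenIndex l)}
    (hF : ∀ c ∈ F, c.swap ∈ F) (ha : a ∉ F) (hp : p ∉ F) {v : EvenIndex l → k} (hv : v ≠ 0)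
    (hvF : ∀ c ∈ F, v c = 0) :
    ∃ x ∈ E, (x *ᵥ v) a = 1 ∧ (∀ c ∈ F, (x *ᵥ v) c = 0) ∧
      ∀ c ∈ F, x *ᵥ Pi.single c 1 = Pi.single c 1 := by
  have hF' : ∀ c, c ∉ F → c.swap ∉ F := fun c hc h => hc (by simpa using hF _ h)
  have fixes : ∀ (b b' : EvenIndex l) (t : k), b ∉ F → b' ∉ F →
      (∀ c ∈ F, rootMatrix ε b b' t *ᵥ Pi.single c 1 = Pi.single c 1) := by
    intro b b' t hb hb' c hc
    have h1 : b' ≠ c := fun h => hb' (h ▸ hc)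
    have h2 : b.swap ≠ c := fun h => hF' _ hb (h ▸ hc)
    rw [rootMatrix_mulVec, Pi.single_eq_of_ne h1, Pi.single_eq_of_ne h2]
    simp
  have vanish : ∀ (b b' : EvenIndex l) (t : k) (u : EvenIndex l → k), b ∉ F → b' ∉ F →
      (∀ c ∈ F, u c = 0) → ∀ c ∈ F, (rootMatrix ε b b' t *ᵥ u) c = 0 := by
    intro b b' t u hb hb' hu c hc
    have h1 : c ≠ b := fun h => hb (h ▸ hc)
    have h2 : c ≠ b'.swap := fun h => hF' _ hb' (h ▸ hc)
    simp [rootMatrix_mulVec, h1, h2, hu c hc]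
  have main : ∀ u : EvenIndex l → k, (∀ c ∈ F, u c = 0) → (∃ b, b ≠ a ∧ b ≠ a.swap ∧ u b ≠ 0) →
      ∃ x ∈ E, (x *ᵥ u) a = 1 ∧ (∀ c ∈ F, (x *ᵥ u) c = 0) ∧
        ∀ c ∈ F, x *ᵥ Pi.single c 1 = Pi.single c 1 := by
    rintro u hu ⟨b, hba, hba', hb⟩
    have hbF : b ∉ F := fun h => hb (hu b h)
    have hab : a ≠ b.swap := fun h => hba' (by rw [h, Sum.swap_swap])
    refine ⟨rootMatrix ε a b ((1 - u a) / u b), hE _ _ _ hba.symm hab, ?_,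
      vanish _ _ _ _ ha hbF hu, fixes _ _ _ ha hbF⟩
    simp [rootMatrix_mulVec, hab, hb]
  by_cases h : ∃ b, b ≠ a ∧ b ≠ a.swap ∧ v b ≠ 0
  · exact main v hvF h
  push Not at h
  obtain ⟨d, hd⟩ := Function.ne_iff.1 hv
  have hd' : d = a ∨ d = a.swap := by
    by_contra! hh
    exact hd (h d hh.1 hh.2)
  have hdF : d ∉ F := fun h => hd (hvF d h)
  have hpa : p ≠ a.swap := fun h => hap' (by rw [h, Sum.swap_swap])
  have hpd : p ≠ d ∧ p ≠ d.swap := by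
    rcases hd' with rfl | rfl
    · exact ⟨hap.symm, hpa⟩
    · simpa using ⟨hpa, hap.symm⟩
  -- Here `v` lives on `±a` with `v d ≠ 0`; the root element copies `v d` into the coordinate `p`.
  obtain ⟨x, hx, h1, h2, h3⟩ := main (rootMatrix ε p d 1 *ᵥ v) (vanish _ _ _ _ hp hdF hvF)
    ⟨p, hap.symm, hpa, by simpa [rootMatrix_mulVec, hpd.2, h p hap.symm hpa] using hd⟩
  refine ⟨x * rootMatrix ε p d 1, E.mul_mem hx (hE _ _ _ hpd.1 hpd.2), ?_, ?_, ?_⟩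
  · rwa [← mulVec_mulVec]
  · simpa only [← mulVec_mulVec] using h2
  · intro c hc
    rw [← mulVec_mulVec, fixes _ _ _ hp hdF c hc, h3 c hc]

end Hyperbolic

/-! ### Reduction of an isometry to one hyperbolic plane -/

section Reduction

variable {k : Type*} [Field k] {l : ℕ}

/-- Elimination ends with `x * g = 1`; a left inverse of `x` in the closure must then be `g` itself.
-/
theorem exists_left_inverse_mem_closure {M : Type*} [Monoid M] {s : Set M}
    (hs : ∀ x ∈ s, ∃ y ∈ s, y * x = 1) {x : M} (hx : x ∈ Submonoid.closure s) :
    ∃ y ∈ Submonoid.closure s, y * x = 1 := by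
  induction hx using Submonoid.closure_induction with
  | mem x hx =>
    obtain ⟨y, hy, h⟩ := hs x hx
    exact ⟨y, Submonoid.subset_closure hy, h⟩
  | one => exact ⟨1, Submonoid.one_mem _, one_mul 1⟩
  | mul a b _ _ iha ihb =>
    obtain ⟨a', ha', ha⟩ := iha
    obtain ⟨b', hb', hb⟩ := ihb
    refine ⟨b' * a', Submonoid.mul_mem _ hb' ha', ?_⟩
    rw [mul_assoc, ← mul_assoc a', ha, one_mul, hb]

theorem eq_of_mulVec_single {n : Type*} [Fintype n] [DecidableEq n] {A B : Matrix n n k}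
    (h : ∀ c, A *ᵥ Pi.single c 1 = B *ᵥ Pi.single c 1) : A = B := by
  ext i c
  simpa using congrFun (h c) i

theorem hyperbolicForm_apply_self_of_support {ε : k} {a : EvenIndex l}
    {v : EvenIndex l → k} (hv : ∀ b, b ≠ a → b ≠ a.swap → v b = 0) :
    v ⬝ᵥ hyperbolicForm l ε *ᵥ v = (pairSign ε a + pairSign ε a.swap) * (v a * v a.swap) := by
  rw [dotProduct_hyperbolicForm, ← Finset.sum_subset (Finset.subset_univ {a, a.swap}),
    Finset.sum_pair a.swap_ne_self.symm, Sum.swap_swap]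
  · ring
  · intro c _ hc
    simp only [Finset.mem_insert, Finset.mem_singleton, not_or] at hc
    rw [hv c hc.1 hc.2]
    ring

theorem hyperbolicForm_single_self (ε : k) (a : EvenIndex l) :
    (Pi.single a 1 : EvenIndex l → k) ⬝ᵥ hyperbolicForm l ε *ᵥ Pi.single a 1 = 0 := by
  rw [hyperbolicForm_apply_self_of_support (a := a), Pi.single_eq_of_ne a.swap_ne_self]
  · simp
  · exact fun b hb _ => Pi.single_eq_of_ne hb _

/-- A submonoid of the isometries of the form `(0 I; ε I 0)` that contains all `rootMatrix ε a b t`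
and enough elements supported on hyperbolic planes. -/
structure IsReducing (ε : k) (E : Submonoid (Matrix (EvenIndex l) (EvenIndex l) k)) : Prop where
  mul_self : ε * ε = 1
  root_mem : ∀ a b t, a ≠ b → a ≠ b.swap → rootMatrix ε a b t ∈ E
  le : E ≤ matrixIsometries (hyperbolicForm l ε)
  plane : ∀ (a : EvenIndex l) (v : EvenIndex l → k), v a = 1 →
    (∀ b, b ≠ a → b ≠ a.swap → v b = 0) → v ⬝ᵥ hyperbolicForm l ε *ᵥ v = 0 →
    ∃ y ∈ E, y *ᵥ v = Pi.single a 1 ∧ ∀ c, c ≠ a → y *ᵥ Pi.single c 1 = Pi.single c 1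

namespace IsReducing

variable {ε : k} {E : Submonoid (Matrix (EvenIndex l) (EvenIndex l) k)}

theorem exists_eq_single (h : IsReducing ε E) {a : EvenIndex l} {v : EvenIndex l → k}
    (hv : v a = 1) (hv' : v ⬝ᵥ hyperbolicForm l ε *ᵥ v = 0) :
    ∃ x ∈ E, x *ᵥ v = Pi.single a 1 ∧
      ∀ c, c ≠ a → (c = a.swap ∨ v c.swap = 0) → x *ᵥ Pi.single c 1 = Pi.single c 1 := by
  obtain ⟨x, hx, h1, h2, h3⟩ := exists_clear h.root_mem hv
  obtain ⟨y, hy, h4, h5⟩ := h.plane a (x *ᵥ v) h1 h2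
    (by rw [mem_matrixIsometries_iff.1 (h.le hx), hv'])
  refine ⟨y * x, E.mul_mem hy hx, by rw [← mulVec_mulVec, h4], fun c hc hc' => ?_⟩
  rw [← mulVec_mulVec, h3 c hc hc', h5 c hc]

theorem exists_fixes_pair (h : IsReducing ε E) {g : Matrix (EvenIndex l) (EvenIndex l) k}
    (hg : g ∈ matrixIsometries (hyperbolicForm l ε)) {F : Set (EvenIndex l)}
    (hF : ∀ c ∈ F, c.swap ∈ F) (hgF : ∀ c ∈ F, g *ᵥ Pi.single c 1 = Pi.single c 1)
    {a : EvenIndex l} (ha : a ∉ F) (hga : (g *ᵥ Pi.single a 1) a = 1) :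
    ∃ x ∈ E, (x * g) *ᵥ Pi.single a 1 = Pi.single a 1 ∧
      (x * g) *ᵥ Pi.single a.swap 1 = Pi.single a.swap 1 ∧
      ∀ c ∈ F, (x * g) *ᵥ Pi.single c 1 = Pi.single c 1 := by
  have haF : ∀ c ∈ F, c ≠ a ∧ c ≠ a.swap := fun c hc =>
    ⟨fun e => ha (e ▸ hc), fun e => ha (by simpa [e] using hF c hc)⟩
  obtain ⟨x, hx, h1, h2⟩ := h.exists_eq_single hga
    (by rw [mem_matrixIsometries_iff.1 hg, hyperbolicForm_single_self])
  have hxg := Submonoid.mul_mem _ (h.le hx) hg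
  have fix : ∀ c ∈ F, (x * g) *ᵥ Pi.single c 1 = Pi.single c 1 := by
    intro c hc
    rw [← mulVec_mulVec, hgF c hc, h2 c (haF c hc).1]
    right
    rw [apply_swap_of_fixes h.mul_self hg (hgF c hc), Pi.single_eq_of_ne (haF _ (hF c hc)).1]
  rw [mulVec_mulVec] at h1
  -- Since `x * g` fixes `e_a`, its column at `-a` already has the entry 1 at `-a`.
  obtain ⟨y, hy, h3, h4⟩ := h.exists_eq_single (a := a.swap)
    (v := (x * g) *ᵥ Pi.single a.swap 1)
    (by rw [apply_swap_of_fixes h.mul_self hxg h1, Pi.single_eq_same])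
    (by rw [mem_matrixIsometries_iff.1 hxg, hyperbolicForm_single_self])
  refine ⟨y * x, E.mul_mem hy hx, ?_, ?_, fun c hc => ?_⟩
  · rw [mul_assoc, ← mulVec_mulVec, h1, h4 _ a.swap_ne_self.symm (Or.inl (by simp))]
  · rw [mul_assoc, ← mulVec_mulVec, h3]
  · rw [mul_assoc, ← mulVec_mulVec, fix c hc, h4 c (haF c hc).2]
    right
    rw [apply_swap_of_fixes h.mul_self hxg (fix c hc),
      Pi.single_eq_of_ne (haF _ (hF c hc)).2]

theorem exists_fixes_off (h : IsReducing ε E) {g : Matrix (EvenIndex l) (EvenIndex l) k}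
    (hg : g ∈ matrixIsometries (hyperbolicForm l ε)) (p : Fin l) :
    ∃ x ∈ E, ∀ c : EvenIndex l, c ≠ Sum.inl p → c ≠ Sum.inr p →
      (x * g) *ᵥ Pi.single c 1 = Pi.single c 1 := by
  suffices H : ∀ S : Finset (Fin l), p ∉ S → ∃ x ∈ E, ∀ c : EvenIndex l, Sum.elim id id c ∈ S →
      (x * g) *ᵥ Pi.single c 1 = Pi.single c 1 by
    obtain ⟨x, hx, h1⟩ := H (Finset.univ \ {p}) (by simp)
    refine ⟨x, hx, fun c hc hc' => h1 c ?_⟩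
    rcases c with c | c <;> simp_all
  intro S
  induction S using Finset.induction_on with
  | empty => exact fun _ => ⟨1, E.one_mem, by simp⟩
  | insert i S hi ih =>
    intro hp
    simp only [Finset.mem_insert, not_or] at hp
    obtain ⟨x, hx, h1⟩ := ih hp.2
    have hxg := Submonoid.mul_mem _ (h.le hx) hg
    let F : Set (EvenIndex l) := {c | Sum.elim id id c ∈ S}
    have hF : ∀ c ∈ F, c.swap ∈ F := by
      rintro (c | c) hc <;> simpa [F] using hc
    -- The column is nonzero because it pairs to 1 with the column at `-i`.
    have hne : (x * g) *ᵥ Pi.single (Sum.inl i) 1 ≠ 0 := by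
      intro h0
      have := mem_matrixIsometries_iff.1 hxg (Pi.single (Sum.inl i) 1) (Pi.single (Sum.inr i) 1)
      rw [h0] at this
      simp [hyperbolicForm] at this
    obtain ⟨y, hy, h2, -, h3⟩ := exists_apply_eq_one h.root_mem (a := Sum.inl i) (p := Sum.inl p)
      (by simpa using Ne.symm hp.1) (by simp) hF (by simpa [F] using hi)
      (by simpa [F] using hp.2) hne
      (by
        intro c hc
        rw [← Sum.swap_swap c, apply_swap_of_fixes h.mul_self hxg (h1 _ (hF c hc)), Sum.swap_swap,
          Pi.single_eq_of_ne]
        rintro rfl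
        exact hi hc)
    rw [mulVec_mulVec] at h2
    obtain ⟨z, hz, h4, h5, h6⟩ := h.exists_fixes_pair (Submonoid.mul_mem _ (h.le hy) hxg) hF
      (fun c hc => by rw [← mulVec_mulVec, h1 c hc, h3 c hc]) (by simpa [F] using hi) h2
    refine ⟨z * (y * x), E.mul_mem hz (E.mul_mem hy hx), fun c hc => ?_⟩
    simp only [mul_assoc] at h4 h5 h6 ⊢
    rcases Finset.mem_insert.1 hc with hc | hc
    · rcases c with c | c
      · obtain rfl : c = i := hc
        exact h4
      · obtain rfl : c = i := hc
        exact h5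
    · exact h6 c hc

theorem exists_mul_eq_one (h : IsReducing ε E) {g : Matrix (EvenIndex l) (EvenIndex l) k}
    (hg : g ∈ matrixIsometries (hyperbolicForm l ε)) {p : Fin l}
    (hgp : ∀ c : EvenIndex l, c ≠ Sum.inl p → c ≠ Sum.inr p →
      g *ᵥ Pi.single c 1 = Pi.single c 1)
    (hp : (g *ᵥ Pi.single (Sum.inl p) 1) (Sum.inl p) = 1) : ∃ x ∈ E, x * g = 1 := by
  obtain ⟨x, hx, h1, h2, h3⟩ := h.exists_fixes_pair hg (F := {c | c ≠ Sum.inl p ∧ c ≠ Sum.inr p})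
    (by rintro (c | c) <;> simp) (fun c hc => hgp c hc.1 hc.2) (by simp) hp
  refine ⟨x, hx, eq_of_mulVec_single fun c => ?_⟩
  rw [one_mulVec]
  by_cases hc : c = Sum.inl p
  · rw [hc, h1]
  by_cases hc' : c = Sum.inr p
  · rw [hc']
    exact h2
  exact h3 c ⟨hc, hc'⟩

theorem apply_eq_zero_of_fixes_off (hε : ε * ε = 1) {g : Matrix (EvenIndex l) (EvenIndex l) k}
    (hg : g ∈ matrixIsometries (hyperbolicForm l ε)) {p : Fin l}
    (hgp : ∀ c : EvenIndex l, c ≠ Sum.inl p → c ≠ Sum.inr p →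
      g *ᵥ Pi.single c 1 = Pi.single c 1) {c : EvenIndex l} (hc : c ≠ Sum.inl p)
    (hc' : c ≠ Sum.inr p) : (g *ᵥ Pi.single (Sum.inl p) 1) c = 0 := by
  have h1 : c.swap ≠ Sum.inl p := fun e => hc' (by simpa using congrArg Sum.swap e)
  have h2 : c.swap ≠ Sum.inr p := fun e => hc (by simpa using congrArg Sum.swap e)
  rw [← Sum.swap_swap c, apply_swap_of_fixes hε hg (hgp _ h1 h2), Sum.swap_swap,
    Pi.single_eq_of_ne hc]

end IsReducing

end Reduction

/-! ### Root elements up to `(a, b) ↦ (-b, -a)` -/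

section Root

variable {k : Type*} [Field k] {l : ℕ}

theorem rootMatrix_cases {ε : k} (hε : ε * ε = 1)
    {P : Matrix (EvenIndex l) (EvenIndex l) k → Prop}
    (hpp : ∀ (i j : Fin l) (t : k), i ≠ j → P (rootMatrix ε (Sum.inl i) (Sum.inl j) t))
    (hpn : ∀ (i j : Fin l) (t : k), i < j → P (rootMatrix ε (Sum.inl i) (Sum.inr j) t))
    (hnp : ∀ (i j : Fin l) (t : k), i < j → P (rootMatrix ε (Sum.inr i) (Sum.inl j) t))
    {a b : EvenIndex l} (h1 : a ≠ b) (h2 : a ≠ b.swap) (t : k) : P (rootMatrix ε a b t) := by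
  rcases a with i | i <;> rcases b with j | j
  · exact hpp i j t (by simpa using h1)
  · rcases lt_or_gt_of_ne (show i ≠ j by simpa using h2) with h | h
    · exact hpn i j t h
    · rw [← rootMatrix_swap hε]
      exact hpn j i _ h
  · rcases lt_or_gt_of_ne (show i ≠ j by simpa using h2) with h | h
    · exact hnp i j t h
    · rw [← rootMatrix_swap hε]
      exact hnp j i _ h
  · rw [← rootMatrix_swap hε]
    exact hpp j i _ (by simpa using Ne.symm h1)

end Root

/-! ### The symplectic group -/

section Symplectic

variable {k : Type*} [Field k] {l : ℕ}

theorem alternatingForm_eq : alternatingForm l k = hyperbolicForm l (-1 : k) := by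
  simp [alternatingForm, hyperbolicForm]

theorem one_add_single_mulVec {n : Type*} [Fintype n] [DecidableEq n] (a b : n) (t : k)
    (v : n → k) : (1 + t • single a b 1 : Matrix n n k) *ᵥ v = v + Pi.single a (t * v b) := by
  simp only [add_mulVec, smul_mulVec, one_mulVec, single_mulVec]
  ext c
  simp [Pi.single_apply, Function.update_apply]

theorem transvection_mem (a : EvenIndex l) (t : k) :
    1 + t • single a a.swap (1 : k) ∈ matrixIsometries (hyperbolicForm l (-1 : k)) := by
  rw [mem_matrixIsometries_iff]
  intro v w
  have e : ∀ c d : EvenIndex l, (c.swap = d) = (c = d.swap) :=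
    fun c d => propext EvenIndex.swap_eq_iff
  simp only [one_add_single_mulVec, dotProduct_hyperbolicForm, Pi.add_apply, Pi.single_apply, e,
    mul_add, add_mul, Finset.sum_add_distrib, mul_ite, ite_mul, mul_zero, zero_mul,
    Finset.sum_ite_eq', Finset.mem_univ, if_true, a.swap_ne_self.symm, if_false,
    pairSign_swap (show (-1 : k) * -1 = 1 by ring)]
  ring

theorem isElementarySymplectic_root {a b : EvenIndex l} (h1 : a ≠ b) (h2 : a ≠ b.swap) (t : k) :
    IsElementarySymplectic (rootMatrix (-1) a b t) := by
  refine rootMatrix_cases (by ring) ?_ ?_ ?_ h1 h2 t <;> intro i j t h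
  · simpa [rootMatrix, pairSign] using IsElementarySymplectic.xPosPos i j t h
  · simpa [rootMatrix, pairSign] using IsElementarySymplectic.xPosNeg i j t h
  · simpa [rootMatrix, pairSign] using IsElementarySymplectic.xNegPos i j t h

theorem isElementarySymplectic_transvection (a : EvenIndex l) (t : k) :
    IsElementarySymplectic (1 + t • single a a.swap (1 : k)) := by
  rcases a with i | i
  · exact .xPosNegSelf i t
  · exact .xNegPosSelf i t

theorem IsElementarySymplectic.eq_root_or_transvection
    {x : Matrix (EvenIndex l) (EvenIndex l) k} (hx : IsElementarySymplectic x) :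
    (∃ a b t, a ≠ b ∧ a ≠ b.swap ∧ x = rootMatrix (-1) a b t) ∨
      ∃ (a : EvenIndex l) (t : k), x = 1 + t • single a a.swap 1 := by
  cases hx with
  | xPosPos i j t h =>
    exact Or.inl ⟨Sum.inl i, Sum.inl j, t, by simpa, by simp, by simp [rootMatrix, pairSign]⟩
  | xPosNeg i j t h =>
    exact Or.inl ⟨Sum.inl i, Sum.inr j, t, by simp, by simpa using h.ne,
      by simp [rootMatrix, pairSign]⟩
  | xNegPos i j t h =>
    exact Or.inl ⟨Sum.inr i, Sum.inl j, t, by simp, by simpa using h.ne,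
      by simp [rootMatrix, pairSign]⟩
  | xPosNegSelf i t => exact Or.inr ⟨Sum.inl i, t, rfl⟩
  | xNegPosSelf i t => exact Or.inr ⟨Sum.inr i, t, rfl⟩

theorem IsElementarySymplectic.exists_left_inverse
    {x : Matrix (EvenIndex l) (EvenIndex l) k} (hx : IsElementarySymplectic x) :
    ∃ y, IsElementarySymplectic y ∧ y * x = 1 := by
  rcases hx.eq_root_or_transvection with ⟨a, b, t, h1, h2, rfl⟩ | ⟨a, t, rfl⟩
  · exact ⟨_, isElementarySymplectic_root h1 h2 (-t), rootMatrix_neg_mul h1 h2 t⟩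
  · refine ⟨_, isElementarySymplectic_transvection a (-t), ?_⟩
    simp [add_mul, mul_add, single_mul_single_of_ne, a.swap_ne_self]

theorem isReducing_symplectic : IsReducing (-1 : k)
    (Submonoid.closure {x : Matrix (EvenIndex l) (EvenIndex l) k | IsElementarySymplectic x}) where
  mul_self := by ring
  root_mem a b t h1 h2 := Submonoid.subset_closure (isElementarySymplectic_root h1 h2 t)
  le := by
    rw [Submonoid.closure_le]
    intro x hx
    rcases IsElementarySymplectic.eq_root_or_transvection hx with
      ⟨a, b, t, h1, h2, rfl⟩ | ⟨a, t, rfl⟩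
    · exact rootMatrix_mem (by ring) h1 h2 t
    · exact transvection_mem a t
  plane a v h1 h2 _ := by
    -- This transvection subtracts `v (-a)` times the pivot from the coordinate `-a`.
    have hm := isElementarySymplectic_transvection a.swap (-v a.swap)
    rw [Sum.swap_swap] at hm
    refine ⟨_, Submonoid.subset_closure hm, ?_, fun c hc => ?_⟩
    · rw [one_add_single_mulVec, h1]
      ext c
      by_cases hc : c = a
      · subst hc
        simp [h1, c.swap_ne_self.symm]
      by_cases hc' : c = a.swap
      · subst hc'
        simp [hc]
      · simp [hc, hc', h2 c hc hc']
    · rw [one_add_single_mulVec, Pi.single_eq_of_ne hc.symm]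
      simp

theorem mem_closure_isElementarySymplectic (hl : 0 < l)
    {g : Matrix (EvenIndex l) (EvenIndex l) k} (hg : g ∈ symplecticMatrices l k) :
    g ∈ Submonoid.closure {x | IsElementarySymplectic x} := by
  set E := Submonoid.closure {x : Matrix (EvenIndex l) (EvenIndex l) k | IsElementarySymplectic x}
  have hR : IsReducing (-1 : k) E := isReducing_symplectic
  rw [symplecticMatrices, alternatingForm_eq] at hg
  let p : Fin l := ⟨0, hl⟩
  suffices H : ∃ x ∈ E, x * g = 1 by
    obtain ⟨x, hx, hxg⟩ := H
    obtain ⟨y, hy, hyx⟩ := exists_left_inverse_mem_closure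
      (fun x hx => IsElementarySymplectic.exists_left_inverse hx) hx
    rwa [← left_inv_eq_right_inv hyx hxg]
  obtain ⟨x, hx, h1⟩ := hR.exists_fixes_off hg p
  have hxg := Submonoid.mul_mem _ (hR.le hx) hg
  have fixes : ∀ (a c : EvenIndex l) (t : k), c ≠ a.swap →
      (1 + t • single a a.swap 1 : Matrix (EvenIndex l) (EvenIndex l) k) *ᵥ Pi.single c 1 =
        Pi.single c 1 := by
    intro a c t hc
    rw [one_add_single_mulVec, Pi.single_eq_of_ne hc.symm]
    simp
  have fin : ∀ g ∈ matrixIsometries (hyperbolicForm l (-1 : k)),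
      (∀ c : EvenIndex l, c ≠ Sum.inl p → c ≠ Sum.inr p →
        g *ᵥ Pi.single c 1 = Pi.single c 1) →
      (g *ᵥ Pi.single (Sum.inl p) 1) (Sum.inr p) ≠ 0 → ∃ x ∈ E, x * g = 1 := by
    intro g hg h1 h2
    set v := g *ᵥ Pi.single (Sum.inl p) 1 with hv
    -- The parameter is chosen so that adding it times the entry at `-p` turns the entry at `p` into
    -- 1.
    have hy := isElementarySymplectic_transvection (Sum.inl p : EvenIndex l)
      ((1 - v (Sum.inl p)) / v (Sum.inr p))
    obtain ⟨z, hz, hzy⟩ := hR.exists_mul_eq_one (p := p)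
      (Submonoid.mul_mem _ (hR.le (Submonoid.subset_closure hy)) hg)
      (fun c hc hc' => by rw [← mulVec_mulVec, h1 c hc hc', fixes _ _ _ hc'])
      (by
        rw [← mulVec_mulVec, ← hv, one_add_single_mulVec]
        simp [h2])
    exact ⟨_, E.mul_mem hz (Submonoid.subset_closure hy), by rw [mul_assoc, hzy]⟩
  by_cases h2 : ((x * g) *ᵥ Pi.single (Sum.inl p) 1) (Sum.inr p) = 0
  -- If the entry at `-p` is zero, the one at `p` is not, and is added to it.
  · have hy := isElementarySymplectic_transvection (Sum.inr p : EvenIndex l) (1 : k)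
    have hyg := Submonoid.mul_mem _ (hR.le (Submonoid.subset_closure hy)) hxg
    have h3 : ((x * g) *ᵥ Pi.single (Sum.inl p) 1) (Sum.inl p) ≠ 0 := by
      intro h3
      have h4 : (x * g) *ᵥ Pi.single (Sum.inl p) 1 = 0 := by
        ext c
        by_cases hc : c = Sum.inl p
        · rw [hc, h3]; rfl
        by_cases hc' : c = Sum.inr p
        · rw [hc', h2]; rfl
        · exact IsReducing.apply_eq_zero_of_fixes_off hR.mul_self hxg h1 hc hc'
      have := mem_matrixIsometries_iff.1 hxg (Pi.single (Sum.inl p) 1) (Pi.single (Sum.inr p) 1)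
      rw [h4] at this
      simp [hyperbolicForm] at this
    obtain ⟨z, hz, hzy⟩ := fin _ hyg
      (fun c hc hc' => by rw [← mulVec_mulVec, h1 c hc hc', fixes _ _ _ hc])
      (by
        rw [← mulVec_mulVec, one_add_single_mulVec, Pi.add_apply, h2, Pi.single_eq_same]
        simpa using h3)
    refine ⟨_, E.mul_mem hz (E.mul_mem (Submonoid.subset_closure hy) hx), ?_⟩
    rw [mul_assoc, mul_assoc, hzy]
  · obtain ⟨z, hz, hzx⟩ := fin _ hxg h1 h2
    exact ⟨_, E.mul_mem hz hx, by rw [mul_assoc, hzx]⟩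

end Symplectic

/-! ### The even orthogonal group -/

section OrthogonalEven

variable {k : Type*} [Field k] {l : ℕ}

theorem splitFormEven_eq : splitFormEven l k = hyperbolicForm l (1 : k) := by
  simp [splitFormEven, hyperbolicForm]

/-- The matrix `w_p = I - e_{p,p} - e_{-p,-p} - e_{p,-p} - e_{-p,p}`. -/
def negSwap (k : Type*) [Field k] (p : Fin l) : Matrix (EvenIndex l) (EvenIndex l) k :=
  1 - single (Sum.inl p) (Sum.inl p) 1 - single (Sum.inr p) (Sum.inr p) 1
    - single (Sum.inl p) (Sum.inr p) 1 - single (Sum.inr p) (Sum.inl p) 1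

theorem negSwap_mulVec (p : Fin l) (v : EvenIndex l → k) :
    negSwap k p *ᵥ v = v - Pi.single (Sum.inl p) (v (Sum.inl p) + v (Sum.inr p))
      - Pi.single (Sum.inr p) (v (Sum.inl p) + v (Sum.inr p)) := by
  simp only [negSwap, sub_mulVec, one_mulVec, single_mulVec]
  ext c
  simp [Pi.single_apply, Function.update_apply]
  split_ifs <;> ring

theorem negSwap_mul_self (p : Fin l) : negSwap k p * negSwap k p = 1 := by
  refine eq_of_mulVec_single fun c => ?_
  rw [← mulVec_mulVec, one_mulVec]
  generalize (Pi.single c 1 : EvenIndex l → k) = v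
  simp only [negSwap_mulVec]
  ext c
  by_cases hc : c = Sum.inl p
  · subst hc; simp
  by_cases hc' : c = Sum.inr p
  · subst hc'; simp
  simp [hc, hc']

theorem negSwap_mem (p : Fin l) :
    negSwap k p ∈ matrixIsometries (hyperbolicForm l (1 : k)) := by
  rw [mem_matrixIsometries_iff]
  intro v w
  simp only [negSwap_mulVec, dotProduct_hyperbolicForm, Fintype.sum_sum_type, Pi.sub_apply,
    Pi.single_apply, Sum.swap_inl, Sum.swap_inr, pairSign, Sum.elim_inl, Sum.elim_inr,
    Sum.inl.injEq, Sum.inr.injEq, reduceCtorEq, if_false, one_mul, sub_zero,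
    mul_sub, sub_mul, Finset.sum_sub_distrib, mul_ite, ite_mul, mul_zero, zero_mul,
    Finset.sum_ite_eq', Finset.mem_univ, if_true, Finset.sum_const_zero]
  ring

theorem isElementaryEven_root {a b : EvenIndex l} (h1 : a ≠ b) (h2 : a ≠ b.swap) (t : k) :
    IsElementaryEven (rootMatrix (1) a b t) := by
  refine rootMatrix_cases (by ring) ?_ ?_ ?_ h1 h2 t <;> intro i j t h
  · simpa [rootMatrix, pairSign] using IsElementaryEven.xPosPos i j t h
  · simpa [rootMatrix, pairSign] using IsElementaryEven.xPosNeg i j t h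
  · simpa [rootMatrix, pairSign] using IsElementaryEven.xNegPos i j t h

theorem IsElementaryEven.eq_root_or_negSwap
    {x : Matrix (EvenIndex l) (EvenIndex l) k} (hx : IsElementaryEven x) :
    (∃ a b t, a ≠ b ∧ a ≠ b.swap ∧ x = rootMatrix 1 a b t) ∨
      ∃ p : Fin l, (p : ℕ) + 1 = l ∧ x = negSwap k p := by
  cases hx with
  | xPosPos i j t h =>
    exact Or.inl ⟨Sum.inl i, Sum.inl j, t, by simpa, by simp, by simp [rootMatrix, pairSign]⟩
  | xPosNeg i j t h =>
    exact Or.inl ⟨Sum.inl i, Sum.inr j, t, by simp, by simpa using h.ne,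
      by simp [rootMatrix, pairSign]⟩
  | xNegPos i j t h =>
    exact Or.inl ⟨Sum.inr i, Sum.inl j, t, by simp, by simpa using h.ne,
      by simp [rootMatrix, pairSign]⟩
  | w p h => exact Or.inr ⟨p, h, rfl⟩

theorem IsElementaryEven.exists_left_inverse
    {x : Matrix (EvenIndex l) (EvenIndex l) k} (hx : IsElementaryEven x) :
    ∃ y, IsElementaryEven y ∧ y * x = 1 := by
  rcases hx.eq_root_or_negSwap with ⟨a, b, t, h1, h2, rfl⟩ | ⟨p, hp, rfl⟩
  · exact ⟨_, isElementaryEven_root h1 h2 (-t), rootMatrix_neg_mul h1 h2 t⟩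
  · exact ⟨_, .w p hp, negSwap_mul_self p⟩

theorem isReducing_orthogonal (h2 : (2 : k) ≠ 0) : IsReducing (1 : k)
    (Submonoid.closure {x : Matrix (EvenIndex l) (EvenIndex l) k | IsElementaryEven x}) where
  mul_self := by ring
  root_mem a b t h1 h2 := Submonoid.subset_closure (isElementaryEven_root h1 h2 t)
  le := by
    rw [Submonoid.closure_le]
    intro x hx
    rcases IsElementaryEven.eq_root_or_negSwap hx with ⟨a, b, t, h1, h2, rfl⟩ | ⟨p, hp, rfl⟩
    · exact rootMatrix_mem (by ring) h1 h2 t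
    · exact negSwap_mem p
  plane a v h1 h3 h4 := by
    -- No operation is needed: isotropy reads `2 * v (-a) = 0`, so `v` is already `e_a`.
    refine ⟨1, Submonoid.one_mem _, ?_, fun c _ => one_mulVec _⟩
    rw [hyperbolicForm_apply_self_of_support h3, h1, one_mul] at h4
    have h5 : v a.swap = 0 := by
      rcases a with a | a <;> simpa [pairSign, one_add_one_eq_two, h2] using h4
    rw [one_mulVec]
    ext c
    by_cases hc : c = a
    · rw [hc, h1, Pi.single_eq_same]
    rw [Pi.single_eq_of_ne hc]
    by_cases hc' : c = a.swap
    · rw [hc', h5]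
    · exact h3 c hc hc'

theorem diagEven_inv_mul (u : kˣ) : diagEven l u⁻¹ * diagEven l u = 1 := by
  rw [diagEven, diagEven, diagonal_mul_diagonal, ← diagonal_one]
  congr 1
  ext (c | c) <;> simp only [diagEntries, Sum.elim_inl, Sum.elim_inr] <;> split_ifs <;> simp

theorem diagEven_mem (u : kˣ) : diagEven l u ∈ matrixIsometries (hyperbolicForm l (1 : k)) := by
  rw [mem_matrixIsometries_iff]
  intro v w
  simp only [dotProduct_hyperbolicForm]
  refine Finset.sum_congr rfl fun c _ => ?_
  simp only [diagEven, mulVec_diagonal]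
  rcases c with c | c <;>
    simp only [diagEntries, Sum.elim_inl, Sum.elim_inr, Sum.swap_inl, Sum.swap_inr] <;>
    split_ifs <;> field_simp

theorem exists_mul_diagEven (hl : 0 < l) (h2 : (2 : k) ≠ 0)
    {g : Matrix (EvenIndex l) (EvenIndex l) k} (hg : g ∈ splitOrthogonalEven l k) :
    ∃ x ∈ Submonoid.closure {x | IsElementaryEven x}, ∃ u : kˣ, g = x * diagEven l u := by
  set E := Submonoid.closure {x : Matrix (EvenIndex l) (EvenIndex l) k | IsElementaryEven x}
  have hR : IsReducing (1 : k) E := isReducing_orthogonal h2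
  rw [splitOrthogonalEven, splitFormEven_eq] at hg
  let p : Fin l := ⟨l - 1, by omega⟩
  have hp : (p : ℕ) + 1 = l := by simp only [p]; omega
  suffices H : ∃ x ∈ E, ∃ u : kˣ, x * (g * diagEven l u) = 1 by
    obtain ⟨x, hx, u, hxg⟩ := H
    obtain ⟨y, hy, hyx⟩ := exists_left_inverse_mem_closure
      (fun x hx => IsElementaryEven.exists_left_inverse hx) hx
    refine ⟨y, hy, u⁻¹, ?_⟩
    have hd := diagEven_inv_mul (l := l) u⁻¹
    rw [inv_inv] at hd
    rw [left_inv_eq_right_inv hyx hxg, mul_assoc, hd, mul_one]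
  have fin : ∀ g ∈ matrixIsometries (hyperbolicForm l (1 : k)),
      (∀ c : EvenIndex l, c ≠ Sum.inl p → c ≠ Sum.inr p →
        g *ᵥ Pi.single c 1 = Pi.single c 1) →
      (g *ᵥ Pi.single (Sum.inl p) 1) (Sum.inl p) ≠ 0 →
      ∃ x ∈ E, ∃ u : kˣ, x * (g * diagEven l u) = 1 := by
    intro g hg h1 h3
    have hd : ∀ (u : kˣ) (c : EvenIndex l), diagEven l u *ᵥ Pi.single c 1 =
        diagEntries l u c • Pi.single c 1 := by
      intro u c
      ext d
      by_cases h : d = c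
      · subst h; simp [diagEven]
      · simp [diagEven, h]
    -- Right multiplication by the diagonal matrix scales column `p` by the inverse of its pivot and
    -- keeps the columns outside `±p`.
    obtain ⟨x, hx, hxg⟩ := hR.exists_mul_eq_one (p := p)
      (Submonoid.mul_mem _ hg (diagEven_mem (Units.mk0 _ h3)⁻¹))
      (fun c hc hc' => by
        have h4 : diagEntries l (Units.mk0 _ h3)⁻¹ c = 1 := by
          rcases c with c | c
          · have : (c : ℕ) + 1 ≠ l := fun e => hc (congrArg Sum.inl (Fin.ext (by omega)))
            simp [diagEntries, this]
          · have : (c : ℕ) + 1 ≠ l := fun e => hc' (congrArg Sum.inr (Fin.ext (by omega)))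
            simp [diagEntries, this]
        rw [← mulVec_mulVec, hd, h4, one_smul, h1 c hc hc'])
      (by
        rw [← mulVec_mulVec, hd, mulVec_smul, Pi.smul_apply, smul_eq_mul]
        simp only [diagEntries, Sum.elim_inl, hp, if_true, Units.val_inv_eq_inv_val,
          Units.val_mk0]
        exact inv_mul_cancel₀ h3)
    exact ⟨x, hx, _, hxg⟩
  obtain ⟨x, hx, h1⟩ := hR.exists_fixes_off hg p
  have hxg := Submonoid.mul_mem _ (hR.le hx) hg
  by_cases h3 : ((x * g) *ᵥ Pi.single (Sum.inl p) 1) (Sum.inl p) = 0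
  -- If the pivot vanishes, `w_l` replaces it by minus the entry at `-p`, which is nonzero.
  · have hw : negSwap k p ∈ E := Submonoid.subset_closure (.w p hp)
    have h4 : ((x * g) *ᵥ Pi.single (Sum.inl p) 1) (Sum.inr p) ≠ 0 := by
      intro h4
      have h5 : (x * g) *ᵥ Pi.single (Sum.inl p) 1 = 0 := by
        ext c
        by_cases hc : c = Sum.inl p
        · rw [hc, h3]; rfl
        by_cases hc' : c = Sum.inr p
        · rw [hc', h4]; rfl
        · exact IsReducing.apply_eq_zero_of_fixes_off hR.mul_self hxg h1 hc hc'
      have := mem_matrixIsometries_iff.1 hxg (Pi.single (Sum.inl p) 1) (Pi.single (Sum.inr p) 1)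
      rw [h5] at this
      simp [hyperbolicForm] at this
    obtain ⟨z, hz, u, hzu⟩ := fin _ (Submonoid.mul_mem _ (hR.le hw) hxg)
      (fun c hc hc' => by
        rw [← mulVec_mulVec, h1 c hc hc', negSwap_mulVec, Pi.single_eq_of_ne hc.symm,
          Pi.single_eq_of_ne hc'.symm]
        simp)
      (by
        rw [← mulVec_mulVec, negSwap_mulVec, Pi.sub_apply, Pi.sub_apply, h3]
        simpa using h4)
    refine ⟨z * (negSwap k p * x), E.mul_mem hz (E.mul_mem hw hx), u, ?_⟩
    rw [← hzu]
    simp only [mul_assoc]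
  · obtain ⟨z, hz, u, hzu⟩ := fin _ hxg h1 h3
    refine ⟨z * x, E.mul_mem hz hx, u, ?_⟩
    rw [← hzu]
    simp only [mul_assoc]

end OrthogonalEven

/-! ### The odd orthogonal group -/

section OrthogonalOdd

variable {k : Type*} [Field k] {l : ℕ}

/-- The block diagonal matrix `diag(c, X)` of size `2l + 1`. -/
def oddBlock (c : k) (X : Matrix (EvenIndex l) (EvenIndex l) k) :
    Matrix (OddIndex l) (OddIndex l) k :=
  fromBlocks (diagonal fun _ => c) 0 0 X

theorem oddBlock_mul (c d : k) (X Y : Matrix (EvenIndex l) (EvenIndex l) k) :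
    oddBlock c X * oddBlock d Y = oddBlock (c * d) (X * Y) := by
  simp [oddBlock, fromBlocks_multiply]

theorem oddBlock_one : oddBlock 1 (1 : Matrix (EvenIndex l) (EvenIndex l) k) = 1 := by
  simp [oddBlock]

theorem oddBlock_mulVec_zero (c : k) (X : Matrix (EvenIndex l) (EvenIndex l) k)
    (v : OddIndex l → k) : (oddBlock c X *ᵥ v) OddIndex.zero = c * v OddIndex.zero := by
  rw [oddBlock, fromBlocks_mulVec]
  simp

theorem oddBlock_mulVec_inr (c : k) (X : Matrix (EvenIndex l) (EvenIndex l) k)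
    (v : OddIndex l → k) (a : EvenIndex l) :
    (oddBlock c X *ᵥ v) (Sum.inr a) = (X *ᵥ (v ∘ Sum.inr)) a := by
  rw [oddBlock, fromBlocks_mulVec]
  simp

theorem diagOdd_eq (th : k) (u : kˣ) : diagOdd l th u = oddBlock th (diagEven l u) := by
  rw [oddBlock, diagEven, fromBlocks_diagonal, diagOdd]

theorem oddBlock_mem_iff {c : k} (hc : c * c = 1) {X : Matrix (EvenIndex l) (EvenIndex l) k} :
    oddBlock c X ∈ splitOrthogonalOdd l k ↔ X ∈ splitOrthogonalEven l k := by
  have h : (oddBlock c X)ᵀ * splitFormOdd l k * oddBlock c X =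
      fromBlocks (diagonal fun _ => 2) 0 0 (Xᵀ * splitFormEven l k * X) := by
    have : c * 2 * c = 2 := by linear_combination 2 * hc
    simp [oddBlock, splitFormOdd, fromBlocks_transpose, fromBlocks_multiply, this]
  change (oddBlock c X)ᵀ * splitFormOdd l k * oddBlock c X = splitFormOdd l k ↔
    Xᵀ * splitFormEven l k * X = splitFormEven l k
  rw [h, splitFormOdd, fromBlocks_inj]
  simp

theorem dotProduct_splitFormOdd (v w : OddIndex l → k) :
    v ⬝ᵥ splitFormOdd l k *ᵥ w = 2 * v OddIndex.zero * w OddIndex.zero +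
      ∑ c : EvenIndex l, v (Sum.inr c) * w (Sum.inr c.swap) := by
  have h := dotProduct_hyperbolicForm (1 : k) (v ∘ Sum.inr) (w ∘ Sum.inr)
  have hs : ∀ c : EvenIndex l, pairSign (1 : k) c = 1 := by
    rintro (c | c) <;> rfl
  simp only [hs, one_mul, ← splitFormEven_eq, Function.comp_apply] at h
  rw [← h, splitFormOdd, fromBlocks_mulVec]
  simp only [dotProduct, Fintype.sum_sum_type (α₁ := Unit), Sum.elim_inl, Sum.elim_inr,
    zero_mulVec, zero_add, add_zero, Finset.univ_unique, Finset.sum_singleton, mulVec_diagonal,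
    Function.comp_apply, PUnit.default_eq_unit]
  ring

/-- The matrix `I + t (2 e_{a,0} - e_{0,-a}) - t² e_{a,-a}`. -/
def shortRootMatrix (a : EvenIndex l) (t : k) : Matrix (OddIndex l) (OddIndex l) k :=
  1 + t • (single (Sum.inr a) OddIndex.zero 2 - single OddIndex.zero (Sum.inr a.swap) 1)
    - t ^ 2 • single (Sum.inr a) (Sum.inr a.swap) 1

theorem shortRootMatrix_mulVec (a : EvenIndex l) (t : k) (v : OddIndex l → k) :
    shortRootMatrix a t *ᵥ v = v
      + (Pi.single (Sum.inr a) (2 * t * v OddIndex.zero - t ^ 2 * v (Sum.inr a.swap)) :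
          OddIndex l → k)
      - (Pi.single OddIndex.zero (t * v (Sum.inr a.swap)) : OddIndex l → k) := by
  simp only [shortRootMatrix, add_mulVec, sub_mulVec, smul_mulVec, one_mulVec, single_mulVec]
  ext (c | c)
  · simp
    ring
  · by_cases h : c = a
    · subst h
      simp
      ring
    · simp [h]

theorem shortRootMatrix_neg_mul (a : EvenIndex l) (t : k) :
    shortRootMatrix a (-t) * shortRootMatrix a t = 1 := by
  refine eq_of_mulVec_single fun c => ?_
  rw [← mulVec_mulVec, one_mulVec]
  generalize (Pi.single c 1 : OddIndex l → k) = v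
  simp only [shortRootMatrix_mulVec]
  ext (c | c)
  · simp [a.swap_ne_self]
  · by_cases h : c = a
    · subst h
      simp [c.swap_ne_self]
      ring
    · simp [h]

theorem shortRootMatrix_mem (a : EvenIndex l) (t : k) :
    shortRootMatrix a t ∈ splitOrthogonalOdd l k := by
  rw [splitOrthogonalOdd, mem_matrixIsometries_iff]
  intro v w
  have e : ∀ c d : EvenIndex l, (c.swap = d) = (c = d.swap) :=
    fun c d => propext EvenIndex.swap_eq_iff
  simp only [dotProduct_splitFormOdd, shortRootMatrix_mulVec, Pi.add_apply, Pi.sub_apply,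
    Pi.single_apply, Sum.inr.injEq, reduceCtorEq, if_false, if_true, e, sub_zero, add_zero,
    mul_add, add_mul, Finset.sum_add_distrib, mul_ite, ite_mul, mul_zero, zero_mul,
    Finset.sum_ite_eq', Finset.mem_univ, a.swap_ne_self.symm]
  ring

/-- This is the usual expression of a Weyl reflection as `x_α x_{-α} x_α`. The corner `-1`
compensates the determinant `-1` of `w_p`, as the right side has determinant 1. -/
theorem negSwap_eq_shortRootMatrix_mul (p : Fin l) :
    oddBlock (-1) (negSwap k p) = shortRootMatrix (Sum.inl p) (-1) *
      (shortRootMatrix (Sum.inr p) (-1) * shortRootMatrix (Sum.inl p) (-1)) := by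
  refine eq_of_mulVec_single fun c => ?_
  simp only [← mulVec_mulVec]
  generalize (Pi.single c 1 : OddIndex l → k) = v
  ext (c | c)
  · rw [oddBlock_mulVec_zero]
    simp [shortRootMatrix_mulVec]
    ring
  · rw [oddBlock_mulVec_inr, negSwap_mulVec]
    by_cases h : c = Sum.inl p
    · subst h
      simp [shortRootMatrix_mulVec]
      ring
    by_cases h' : c = Sum.inr p
    · subst h'
      simp [shortRootMatrix_mulVec]
      ring
    simp [shortRootMatrix_mulVec, h, h']

theorem oddBlock_rootMatrix (a b : EvenIndex l) (t : k) :
    oddBlock 1 (rootMatrix 1 a b t) =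
      1 + t • (single (Sum.inr a) (Sum.inr b) 1 - single (Sum.inr b.swap) (Sum.inr a.swap) 1) := by
  have hs : ∀ c : EvenIndex l, pairSign (1 : k) c = 1 := by
    rintro (c | c) <;> rfl
  refine eq_of_mulVec_single fun c => ?_
  generalize (Pi.single c 1 : OddIndex l → k) = v
  ext (c | c)
  · rw [oddBlock_mulVec_zero]
    simp [add_mulVec, sub_mulVec, smul_mulVec, single_mulVec]
  · rw [oddBlock_mulVec_inr, rootMatrix_mulVec]
    simp [add_mulVec, sub_mulVec, smul_mulVec, single_mulVec, hs, Pi.single_apply,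
      Function.update_apply]
    split_ifs <;> ring

theorem isElementaryOdd_root {a b : EvenIndex l} (h1 : a ≠ b) (h2 : a ≠ b.swap) (t : k) :
    IsElementaryOdd (oddBlock 1 (rootMatrix 1 a b t)) := by
  refine rootMatrix_cases (P := fun X => IsElementaryOdd (oddBlock 1 X)) (by ring)
    ?_ ?_ ?_ h1 h2 t <;> intro i j t h <;> rw [oddBlock_rootMatrix]
  · exact .xPosPos i j t h
  · exact .xPosNeg i j t h
  · exact .xNegPos i j t h

theorem isElementaryOdd_shortRoot (a : EvenIndex l) (t : k) :
    IsElementaryOdd (shortRootMatrix a t) := by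
  rcases a with i | i
  · exact .xPosZero i t
  -- The element `x_{0,i}` is the short root element at `-i` with the parameter negated.
  · have h := IsElementaryOdd.xZeroPos i (-t)
    rw [neg_sq, neg_smul, ← smul_neg, neg_sub] at h
    exact h

theorem IsElementaryOdd.eq_root_or_shortRoot
    {x : Matrix (OddIndex l) (OddIndex l) k} (hx : IsElementaryOdd x) :
    (∃ a b t, a ≠ b ∧ a ≠ b.swap ∧ x = oddBlock 1 (rootMatrix 1 a b t)) ∨
      ∃ a t, x = shortRootMatrix a t := by
  cases hx with
  | xPosPos i j t h =>
    exact Or.inl ⟨Sum.inl i, Sum.inl j, t, by simpa, by simp, (oddBlock_rootMatrix _ _ _).symm⟩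
  | xPosNeg i j t h =>
    exact Or.inl ⟨Sum.inl i, Sum.inr j, t, by simp, by simpa using h.ne,
      (oddBlock_rootMatrix _ _ _).symm⟩
  | xNegPos i j t h =>
    exact Or.inl ⟨Sum.inr i, Sum.inl j, t, by simp, by simpa using h.ne,
      (oddBlock_rootMatrix _ _ _).symm⟩
  | xPosZero i t => exact Or.inr ⟨Sum.inl i, t, rfl⟩
  | xZeroPos i t =>
    refine Or.inr ⟨Sum.inr i, -t, ?_⟩
    rw [shortRootMatrix, neg_sq, neg_smul, ← smul_neg, neg_sub]
    rfl

theorem IsElementaryOdd.exists_left_inverse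
    {x : Matrix (OddIndex l) (OddIndex l) k} (hx : IsElementaryOdd x) :
    ∃ y, IsElementaryOdd y ∧ y * x = 1 := by
  rcases hx.eq_root_or_shortRoot with ⟨a, b, t, h1, h2, rfl⟩ | ⟨a, t, rfl⟩
  · refine ⟨_, isElementaryOdd_root h1 h2 (-t), ?_⟩
    rw [oddBlock_mul, rootMatrix_neg_mul h1 h2, mul_one, oddBlock_one]
  · exact ⟨_, isElementaryOdd_shortRoot a (-t), shortRootMatrix_neg_mul a t⟩

theorem closure_isElementaryOdd_le :
    Submonoid.closure {x : Matrix (OddIndex l) (OddIndex l) k | IsElementaryOdd x} ≤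
      splitOrthogonalOdd l k := by
  rw [Submonoid.closure_le]
  intro x hx
  rcases IsElementaryOdd.eq_root_or_shortRoot hx with ⟨a, b, t, h1, h2, rfl⟩ | ⟨a, t, rfl⟩
  · refine (oddBlock_mem_iff (one_mul 1)).2 ?_
    rw [splitOrthogonalEven, splitFormEven_eq]
    exact rootMatrix_mem (by ring) h1 h2 t
  · exact shortRootMatrix_mem a t

/-- Root elements lift with corner 1 and `w_l` with corner `-1`, so the sign depends on the word. -/
theorem exists_oddBlock_mem_closure {x : Matrix (EvenIndex l) (EvenIndex l) k}
    (hx : x ∈ Submonoid.closure {x | IsElementaryEven x}) :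
    ∃ th : k, (th = 1 ∨ th = -1) ∧ oddBlock th x ∈ Submonoid.closure {x | IsElementaryOdd x} := by
  induction hx using Submonoid.closure_induction with
  | mem x hx =>
    rcases IsElementaryEven.eq_root_or_negSwap hx with ⟨a, b, t, h1, h2, rfl⟩ | ⟨p, hp, rfl⟩
    · exact ⟨1, Or.inl rfl, Submonoid.subset_closure (isElementaryOdd_root h1 h2 t)⟩
    · refine ⟨-1, Or.inr rfl, ?_⟩
      have hm : ∀ a : EvenIndex l, shortRootMatrix a (-1 : k) ∈
          Submonoid.closure {x | IsElementaryOdd x} :=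
        fun a => Submonoid.subset_closure (isElementaryOdd_shortRoot a _)
      rw [negSwap_eq_shortRootMatrix_mul]
      exact Submonoid.mul_mem _ (hm _) (Submonoid.mul_mem _ (hm _) (hm _))
  | one => exact ⟨1, Or.inl rfl, by rw [oddBlock_one]; exact Submonoid.one_mem _⟩
  | mul a b _ _ iha ihb =>
    obtain ⟨s, hs, ha⟩ := iha
    obtain ⟨t, ht, hb⟩ := ihb
    refine ⟨s * t, ?_, by rw [← oddBlock_mul]; exact Submonoid.mul_mem _ ha hb⟩
    rcases hs with rfl | rfl <;> rcases ht with rfl | rfl <;> simp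

theorem dotProduct_splitFormOdd_single_zero (v : OddIndex l → k) :
    Pi.single OddIndex.zero 1 ⬝ᵥ splitFormOdd l k *ᵥ v = 2 * v OddIndex.zero := by
  rw [dotProduct_splitFormOdd]
  simp

theorem exists_mulVec_eq_single_zero (hl : 2 ≤ l) (h2 : (2 : k) ≠ 0) {u : OddIndex l → k}
    (hu : u ⬝ᵥ splitFormOdd l k *ᵥ u = 2) (hu' : u ∘ Sum.inr ≠ 0) :
    ∃ x ∈ Submonoid.closure {x | IsElementaryOdd x}, x *ᵥ u = Pi.single OddIndex.zero 1 := by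
  set E := Submonoid.closure {x : Matrix (OddIndex l) (OddIndex l) k | IsElementaryOdd x}
  let φ : Matrix (EvenIndex l) (EvenIndex l) k →* Matrix (OddIndex l) (OddIndex l) k :=
    { toFun := oddBlock 1
      map_one' := oddBlock_one
      map_mul' := fun X Y => by rw [oddBlock_mul, mul_one] }
  have hroot : ∀ a b t, a ≠ b → a ≠ b.swap → rootMatrix 1 a b t ∈ E.comap φ :=
    fun a b t h1 h2 => Submonoid.subset_closure (isElementaryOdd_root h1 h2 t)
  -- Two distinct positive indices, a pivot and a spare one, are available because `l ≥ 2`.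
  let i : EvenIndex l := Sum.inl ⟨0, by omega⟩
  let p : EvenIndex l := Sum.inl ⟨1, by omega⟩
  obtain ⟨x, hx, h3, -, -⟩ := exists_apply_eq_one hroot (a := i) (p := p) (by simp [i, p])
    (by simp [i, p]) (F := ∅) (by simp) (by simp) (by simp) hu' (by simp)
  obtain ⟨y, hy, h4, h5, -⟩ := exists_clear hroot h3
  set w := (oddBlock 1 (y * x)) *ᵥ u with hw
  have hyx : oddBlock 1 (y * x) ∈ E := Submonoid.mul_mem (E.comap φ) hy hx
  have hwi : w (Sum.inr i) = 1 := by
    rw [hw, oddBlock_mulVec_inr, ← mulVec_mulVec, h4]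
  have hwc : ∀ c, c ≠ i → c ≠ i.swap → w (Sum.inr c) = 0 := by
    intro c hc hc'
    rw [hw, oddBlock_mulVec_inr, ← mulVec_mulVec, h5 c hc hc']
  have hz : ∀ (a : EvenIndex l) (t : k), shortRootMatrix a t ∈ E :=
    fun a t => Submonoid.subset_closure (isElementaryOdd_shortRoot a t)
  -- As `w` has entry 1 at `i`, this subtracts `w 0 - 1` from the coordinate 0, making it 1; apart
  -- from it only the coordinate `-i` changes.
  set z := shortRootMatrix i.swap (w OddIndex.zero - 1) *ᵥ w with hzw
  have hz0 : z OddIndex.zero = 1 := by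
    simp [hzw, shortRootMatrix_mulVec, hwi]
  have hzi : z (Sum.inr i) = 1 := by
    simp [hzw, shortRootMatrix_mulVec, hwi, i]
  have hzc : ∀ c, c ≠ i → c ≠ i.swap → z (Sum.inr c) = 0 := by
    intro c hc hc'
    simp [hzw, shortRootMatrix_mulVec, hwc c hc hc', hc']
  have hzB : z ⬝ᵥ splitFormOdd l k *ᵥ z = 2 := by
    rw [hzw, mem_matrixIsometries_iff.1 (closure_isElementaryOdd_le (hz _ _)), hw,
      mem_matrixIsometries_iff.1 (closure_isElementaryOdd_le hyx), hu]
  -- The form takes the value `2 + 2 z_{-i}` on `z`, and this equals 2.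
  have hzs : z (Sum.inr i.swap) = 0 := by
    rw [dotProduct_splitFormOdd, hz0, ← Finset.sum_subset (Finset.subset_univ {i, i.swap}),
      Finset.sum_pair i.swap_ne_self.symm, Sum.swap_swap, hzi] at hzB
    · have : 2 * z (Sum.inr i.swap) = 0 := by linear_combination hzB
      simpa [h2] using this
    · intro c _ hc
      simp only [Finset.mem_insert, Finset.mem_singleton, not_or] at hc
      rw [hzc c hc.1 hc.2, zero_mul]
  -- Now `z = e_0 + e_i`; the parameter `-1/2` adds `2 * (-1/2) * z_0 = -1` to the coordinate `i`.
  refine ⟨shortRootMatrix i (-2⁻¹) * (shortRootMatrix i.swap (w OddIndex.zero - 1) *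
    oddBlock 1 (y * x)), E.mul_mem (hz _ _) (E.mul_mem (hz _ _) hyx), ?_⟩
  rw [← mulVec_mulVec, ← mulVec_mulVec, ← hw, ← hzw, shortRootMatrix_mulVec, hzs, hz0]
  ext (c | c)
  · simpa using hz0
  · by_cases hc : c = i
    · subst hc
      simp [hzi, h2]
    by_cases hc' : c = i.swap
    · subst hc'
      simp [hzs, hc]
    simp [hzc c hc hc', hc]

/-- Pairing with `e_0` is twice the coordinate 0, so the other columns, orthogonal to the fixed
`e_0`, have no entry there. -/
theorem eq_oddBlock_of_fixes (h2 : (2 : k) ≠ 0) {g : Matrix (OddIndex l) (OddIndex l) k}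
    (hg : g ∈ splitOrthogonalOdd l k)
    (h0 : g *ᵥ Pi.single OddIndex.zero 1 = Pi.single OddIndex.zero 1) :
    g = oddBlock 1 g.toBlocks₂₂ := by
  ext a b
  rcases b with b | b
  · have h := congrFun h0 a
    rcases a with a | a
    · simpa [oddBlock] using h
    · simpa [oddBlock] using h
  · rcases a with a | a
    · have h := mem_matrixIsometries_iff.1 hg (Pi.single OddIndex.zero 1) (Pi.single (Sum.inr b) 1)
      rw [h0, dotProduct_splitFormOdd_single_zero, dotProduct_splitFormOdd_single_zero] at h
      simpa [oddBlock, h2] using h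
    · rfl

theorem exists_mul_diagOdd (hl : 2 ≤ l) (h2 : (2 : k) ≠ 0)
    {g : Matrix (OddIndex l) (OddIndex l) k} (hg : g ∈ splitOrthogonalOdd l k) :
    ∃ x ∈ Submonoid.closure {x | IsElementaryOdd x}, ∃ (th : k) (u : kˣ),
      (th = 1 ∨ th = -1) ∧ g = x * diagOdd l th u := by
  set E := Submonoid.closure {x : Matrix (OddIndex l) (OddIndex l) k | IsElementaryOdd x}
  have sq : ∀ th : k, th = 1 ∨ th = -1 → th * th = 1 := by
    rintro th (rfl | rfl) <;> simp
  have H : ∃ x ∈ E, ∃ th : k, (th = 1 ∨ th = -1) ∧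
      (x * (g * oddBlock th 1)) *ᵥ Pi.single OddIndex.zero 1 = Pi.single OddIndex.zero 1 := by
    set u := g *ᵥ Pi.single OddIndex.zero 1 with hu
    have huB : u ⬝ᵥ splitFormOdd l k *ᵥ u = 2 := by
      rw [hu, mem_matrixIsometries_iff.1 hg, dotProduct_splitFormOdd_single_zero]
      simp
    by_cases hu' : u ∘ Sum.inr = 0
    · have hu0 : ∀ c, u (Sum.inr c) = 0 := congrFun hu'
      have h3 : u OddIndex.zero * u OddIndex.zero = 1 := by
        simp only [dotProduct_splitFormOdd, hu0, mul_zero, Finset.sum_const_zero, add_zero] at huB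
        exact mul_left_cancel₀ h2 (by linear_combination huB)
      -- With no hyperbolic part, `g e_0 = ±e_0`, and a sign on the right corrects it.
      refine ⟨1, E.one_mem, u OddIndex.zero, mul_self_eq_one_iff.1 h3, ?_⟩
      have h4 : oddBlock (u OddIndex.zero) (1 : Matrix (EvenIndex l) (EvenIndex l) k) *ᵥ
          Pi.single OddIndex.zero 1 = u OddIndex.zero • Pi.single OddIndex.zero 1 := by
        ext (c | c)
        · rw [oddBlock_mulVec_zero]; simp
        · rw [oddBlock_mulVec_inr]; simp
      rw [one_mul, ← mulVec_mulVec, h4, mulVec_smul, ← hu]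
      ext (c | c)
      · simpa using h3
      · simp [hu0]
    · obtain ⟨x, hx, hxu⟩ := exists_mulVec_eq_single_zero hl h2 huB hu'
      refine ⟨x, hx, 1, Or.inl rfl, ?_⟩
      rw [oddBlock_one, mul_one, ← mulVec_mulVec, ← hu, hxu]
  obtain ⟨x, hx, th, hth, h3⟩ := H
  have hmem := Submonoid.mul_mem _ (closure_isElementaryOdd_le hx)
    (Submonoid.mul_mem _ hg ((oddBlock_mem_iff (sq th hth)).2 (Submonoid.one_mem _)))
  have h4 := eq_oddBlock_of_fixes h2 hmem h3
  rw [h4, oddBlock_mem_iff (one_mul 1)] at hmem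
  obtain ⟨m, hm, u, hmu⟩ := exists_mul_diagEven (by omega) h2 hmem
  obtain ⟨s, hs, hsm⟩ := exists_oddBlock_mem_closure hm
  obtain ⟨y, hy, hyx⟩ := exists_left_inverse_mem_closure
    (fun x hx => IsElementaryOdd.exists_left_inverse hx) hx
  -- The final sign combines `th`, used to fix `e_0`, with the corner `s` of the lift of `m`; both
  -- have square 1.
  refine ⟨y * oddBlock s m, E.mul_mem hy hsm, s * th, u, ?_, ?_⟩
  · rcases hs with rfl | rfl <;> rcases hth with rfl | rfl <;> simp
  calc g = y * x * g * (oddBlock th 1 * oddBlock th 1) := by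
        rw [hyx, oddBlock_mul, sq th hth, one_mul, one_mul, oddBlock_one, mul_one]
    _ = y * (x * (g * oddBlock th 1)) * oddBlock th 1 := by simp only [mul_assoc]
    _ = y * (oddBlock s m * oddBlock s (diagEven l u)) * oddBlock th 1 := by
        rw [h4, hmu, oddBlock_mul, sq s hs]
    _ = y * oddBlock s m * diagOdd l (s * th) u := by
        rw [diagOdd_eq]
        simp only [mul_assoc, oddBlock_mul, mul_one]

end OrthogonalOdd

/-! ### Membership in the closures as explicit words -/

theorem theoremA {k : Type*} [Field k] (l : ℕ) (hl : 2 ≤ l) :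
    (ringChar k ≠ 2 →
      (∀ g ∈ splitOrthogonalEven l k,
        ∃ (L : List (Matrix (EvenIndex l) (EvenIndex l) k)) (lam : kˣ),
          (∀ x ∈ L, IsElementaryEven x) ∧ g = L.prod * diagEven l lam) ∧
      (∀ g ∈ splitOrthogonalOdd l k,
        ∃ (L : List (Matrix (OddIndex l) (OddIndex l) k)) (th : k) (lam : kˣ),
          (∀ x ∈ L, IsElementaryOdd x) ∧ (th = 1 ∨ th = -1) ∧
            g = L.prod * diagOdd l th lam)) ∧
    (∀ g ∈ symplecticMatrices l k,
      ∃ L : List (Matrix (EvenIndex l) (EvenIndex l) k),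
        (∀ x ∈ L, IsElementarySymplectic x) ∧ g = L.prod) := by
  refine ⟨fun hk => ⟨fun g hg => ?_, fun g hg => ?_⟩, fun g hg => ?_⟩
  · obtain ⟨x, hx, u, rfl⟩ := exists_mul_diagEven (by omega) (Ring.two_ne_zero hk) hg
    obtain ⟨L, hL, rfl⟩ := Submonoid.exists_list_of_mem_closure hx
    exact ⟨L, u, hL, rfl⟩
  · obtain ⟨x, hx, th, u, hth, rfl⟩ := exists_mul_diagOdd hl (Ring.two_ne_zero hk) hg
    obtain ⟨L, hL, rfl⟩ := Submonoid.exists_list_of_mem_closure hx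
    exact ⟨L, th, u, hL, hth, rfl⟩
  · obtain ⟨L, hL, h⟩ := Submonoid.exists_list_of_mem_closure
      (mem_closure_isElementarySymplectic (by omega) hg)
    exact ⟨L, hL, h.symm⟩
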